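/- Let $d\ge 1$, $0<\alpha<2$, and let $(\Omega,\Sigma,P)$ be a probability space. Let $M$ be a symmetric $\alpha$-stable random measure on $([0,1]^d,\mathcal B([0,1]^d))$ with Lebesgue measure $|\cdot|$ as control measure; that is, to each Borel set $A\subset[0,1]^d$ it assigns a real random variable $M(A)$ on $\Omega$ such that - $\mathbb E\,e^{itM(A)}=\exp(-|A|\,|t|^\alpha)$ for all $t\in\mathbb R$ and all $A$; - $M(A_1),\dots,M(A_k)$ are independent whenever $A_1,\dots,A_k$ are pairwise disjoint; - $M(\bigcup_{j}A_j)=\sum_{j=1}^\infty M(A_j)$ almost surely (the series being the limit of its partial sums) whenever $A_1,A_2,\dots$ are pairwise disjoint. For a deterministic $f\in L^\alpha([0,1]^d)$ let $\int f\,dM$ be the almost surely defined limit in probability of $\int f_k\,dM$, where $f_k$ are simple functions with $\int|f_k-f|^\alpha dx\to0$ and $\int\sum_i c_i1_{A_i}\,dM=\sum_i c_iM(A_i)$. Let $U=(U(x))_{x\in[0,1]^d}$ be a symmetric $\alpha$-stable random sheet, i.e. a family of real random variables on $\Omega$ with $$U(x)=\int_{[0,1]^d}1_{\{x'_i\le x_i\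 \text{for all } i\}}\,M(dx')\quad\text{almost surely, for every }x\in[0,1]^d .$$ Then $U$ is an $L^p([0,1]^d)$-valued random variable for every $1\le p<\infty$, in the following sense. The random field $U$ has a version $V$ (that is, $V(x)=U(x)$ almost surely for each $x\in[0,1]^d$) for which $(x,\omega)\mapsto V(x,\omega)$ is jointly measurable; and for every $1\le p<\infty$ there is a Borel measurable map $X:\Omega\to L^p([0,1]^d)$ such that for every jointly measurable version $V$ of $U$ one has, for $P$-almost every $\omega$, $V(\cdot,\omega)\in L^p([0,1]^d)$ and $X(\omega)=V(\cdot,\omega)$ in $L^p([0,1]^d)$. -/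

import Mathlib

open MeasureTheory ProbabilityTheory Filter Topology
open scoped ENNReal

/-- The hypercube `[0,1]^d`; its measurable sets are the Borel sets of `[0,1]^d`. -/
abbrev Cube (d : ℕ) : Type := Set.Icc (0 : Fin d → ℝ) 1

/-- Lebesgue measure on `[0,1]^d`. -/
noncomputable def cubeMeasure (d : ℕ) : Measure (Cube d) :=
  (volume : Measure (Fin d → ℝ)).comap Subtype.val

/-- The law `μ` on `ℝ` is the symmetric `α`-stable law `S_α(σ, 0, 0)`, that is, its characteristic
function is `t ↦ exp (-σ^α |t|^α)`. -/
def IsSymmetricStableLaw (α σ : ℝ) (μ : Measure ℝ) : Prop :=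
  IsProbabilityMeasure μ ∧
    ∀ t : ℝ, charFun μ t = ((Real.exp (-(σ ^ α * |t| ^ α)) : ℝ) : ℂ)

/-- `M` is a symmetric `α`-stable random measure with control measure `m`, defined on the
probability space `(Ω, P)`. Only the values `M A` for measurable `A` with `m A < ∞` are relevant. -/
structure IsSymmetricStableRandomMeasure {Ω E : Type*} [MeasurableSpace Ω] [MeasurableSpace E]
    (α : ℝ) (m : Measure E) (P : Measure Ω) (M : Set E → Ω → ℝ) : Prop where
  /-- Each `M A` is a real random variable. -/
  measurable : ∀ A, MeasurableSet A → m A < ∞ → Measurable (M A)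
  /-- `M A` has the law `S_α(m(A)^{1/α}, 0, 0)`. -/
  law : ∀ A, MeasurableSet A → m A < ∞ →
    IsSymmetricStableLaw α ((m A).toReal ^ (1 / α)) (P.map (M A))
  /-- `M` is independently scattered. -/
  indep : ∀ (k : ℕ) (A : Fin k → Set E), (∀ i, MeasurableSet (A i)) → (∀ i, m (A i) < ∞) →
    Pairwise (fun i j => Disjoint (A i) (A j)) → iIndepFun (fun i => M (A i)) P
  /-- `M` is `σ`-additive: `M (⋃ A_j) = ∑_j M (A_j)` almost surely (limit of partial sums; for
  `α ≥ 1` the series need not converge absolutely). -/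
  sigma_additive : ∀ A : ℕ → Set E, (∀ j, MeasurableSet (A j)) → m (⋃ j, A j) < ∞ →
    Pairwise (fun i j => Disjoint (A i) (A j)) →
    ∀ᵐ ω ∂P, Tendsto (fun n => ∑ j ∈ Finset.range n, M (A j) ω) atTop (𝓝 (M (⋃ j, A j) ω))

/-- The integral `∑ c, c * M {g = c}` of a simple function `g` against `M`. -/
noncomputable def simpleStochIntegral {Ω E : Type*} [MeasurableSpace E]
    (M : Set E → Ω → ℝ) (g : SimpleFunc E ℝ) (ω : Ω) : ℝ :=
  ∑ c ∈ g.range, c * M (g ⁻¹' {c}) ω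

/-- The random variable `Y` is (almost surely) the stochastic integral `∫ f dM`: it is the limit in
probability of the integrals of simple functions that converge to `f` in `L^α(m)`. -/
def IsStochIntegral {Ω E : Type*} [MeasurableSpace Ω] [MeasurableSpace E]
    (α : ℝ) (m : Measure E) (P : Measure Ω) (M : Set E → Ω → ℝ) (f : E → ℝ) (Y : Ω → ℝ) : Prop :=
  MemLp f (ENNReal.ofReal α) m ∧
  ∃ g : ℕ → SimpleFunc E ℝ, (∀ k, (g k).FinMeasSupp m) ∧
    Tendsto (fun k => eLpNorm (fun x => g k x - f x) (ENNReal.ofReal α) m) atTop (𝓝 0) ∧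
    TendstoInMeasure P (fun k => simpleStochIntegral M (g k)) atTop Y

/-- The kernel `f(x, x') = 1` if `x'_i ≤ x_i` for all `i`, and `0` otherwise. -/
noncomputable def sheetKernel {d : ℕ} (x : Cube d) : Cube d → ℝ :=
  Set.indicator {x' : Cube d | ∀ i, (x' : Fin d → ℝ) i ≤ (x : Fin d → ℝ) i} (fun _ => 1)

/-- The random field `U` on `[0,1]^d` is a symmetric `α`-stable random sheet: for some symmetric
`α`-stable random measure `M` on `[0,1]^d` with Lebesgue control measure,
`U(x) = ∫ f(x, x') M(dx')` almost surely, for every `x`. -/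
def IsSymmetricStableSheet {d : ℕ} {Ω : Type*} [MeasurableSpace Ω]
    (α : ℝ) (P : Measure Ω) (U : Cube d → Ω → ℝ) : Prop :=
  (∀ x, Measurable (U x)) ∧
  ∃ M : Set (Cube d) → Ω → ℝ,
    IsSymmetricStableRandomMeasure α (cubeMeasure d) P M ∧
    ∀ x, IsStochIntegral α (cubeMeasure d) P M (sheetKernel x) (U x)

/-- `V` is a version of the random field `U` that is jointly measurable in `(x, ω)`. -/
def IsMeasurableVersion {T Ω : Type*} [MeasurableSpace T] [MeasurableSpace Ω]
    (P : Measure Ω) (U V : T → Ω → ℝ) : Prop :=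
  Measurable (fun z : T × Ω => V z.1 z.2) ∧ ∀ x, V x =ᵐ[P] U x

/-! The sheet is `U x = M [0, x]` almost surely: simple functions close to an indicator in `L^α`
have integrals whose difference from `M A` has characteristic function tending to `1`
(`IsStochIntegral.ae_eq_of_indicator`). Rounding `x` up to the dyadic grid gives orthants decreasing
to `[0, x]`, so the values of `M` on them converge almost surely to `U x`, for each fixed `x`.

Convergence in `L^p` follows once these dyadic values are almost surely bounded uniformly in grid
and corner, although `M` may lack moments. The values of `M` on disjoint cells are independent and
symmetric, so Lévy's reflection argument applies. Used once per coordinate, it bounds the tail of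
the maximum over a grid by `2^d` times the tail of `|M univ|`, whatever the mesh. The `L^p`-limit of
the random step functions is then `X`, and Fubini identifies it with every jointly measurable
version. -/

/-! ### Lévy's maximal inequality, for one and several ranks -/

theorem measurable_pi_indicator {ι : Type*} (A : Set ι) :
    Measurable fun y : ι → ℝ => A.indicator y :=
  measurable_pi_iff.2 fun i => by
    by_cases h : i ∈ A
    · simpa [h] using measurable_pi_apply i
    · simp [h]

/-- **Lévy's maximal inequality** for a law on `ι → ℝ` that is invariant under all changes of sign,
with a convex set in place of the ball of a seminorm. -/
theorem measure_compl_forall_indicator_mem_le {ι : Type*} [Fintype ι] {μ : Measure (ι → ℝ)}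
    (hμ : ∀ A : Set ι, MeasurePreserving (fun y => (2 : ℝ) • A.indicator y - y) μ μ)
    (r : ι → ℕ) {C : Set (ι → ℝ)} (hC : MeasurableSet C) (hconv : Convex ℝ C) :
    μ {y | ∀ k, {i | r i ≤ k}.indicator y ∈ C}ᶜ ≤ 2 * μ Cᶜ := by
  let π : ℕ → (ι → ℝ) → ι → ℝ := fun k y => {i | r i ≤ k}.indicator y
  let T : ℕ → (ι → ℝ) → ι → ℝ := fun k y => (2 : ℝ) • π k y - y
  have hπ : ∀ k, Measurable (π k) := fun k => measurable_pi_indicator _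
  have hπT : ∀ j k, j ≤ k → ∀ y, π j (T k y) = π j y := by
    intro j k hjk y
    ext i
    by_cases h : r i ≤ j
    · simp [π, T, Set.indicator, h, h.trans hjk]; ring
    · simp [π, h]
  let A : ℕ → Set (ι → ℝ) := fun k => (π k ⁻¹' C)ᶜ
  -- `D k` below is the event that the truncations leave `C` first at rank `k`. The reflection `T k`
  -- only flips coordinates of rank above `k`, hence preserves it.
  have hA : ∀ k, MeasurableSet (A k) := fun k => (hπ k hC).compl
  let D : ℕ → Set (ι → ℝ) := disjointed A
  have hD : ∀ k, MeasurableSet (D k) := fun k => MeasurableSet.disjointed hA k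
  have hmem : ∀ k y, y ∈ D k ↔ π k y ∉ C ∧ ∀ j < k, π j y ∈ C := by
    intro k y
    simp [D, disjointed_eq_inter_compl, A]
  have hDT : ∀ k, T k ⁻¹' D k = D k := by
    intro k
    ext y
    simp only [Set.mem_preimage, hmem]
    rw [hπT k k le_rfl]
    refine and_congr_right fun _ => forall₂_congr fun j hj => ?_
    rw [hπT j k hj.le]
  have hle : ∀ k, μ (D k) ≤ 2 * μ (D k ∩ Cᶜ) := by
    intro k
    -- `π k y` is the midpoint of `y` and `T k y`; as it lies outside the convex set `C`, so does
    -- one of these two.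
    have hsub : D k ⊆ (D k ∩ Cᶜ) ∪ T k ⁻¹' (D k ∩ Cᶜ) := by
      intro y hy
      by_contra hcon
      rw [Set.preimage_inter, hDT] at hcon
      simp only [Set.mem_union, Set.mem_inter_iff, hy, true_and, Set.mem_compl_iff,
        Set.mem_preimage, not_or, not_not] at hcon
      refine ((hmem k y).1 hy).1 ?_
      have := hconv hcon.1 hcon.2 (a := 1 / 2) (b := 1 / 2) (by norm_num) (by norm_num)
        (by norm_num)
      convert! this using 1
      ext i
      simp [T]
      ring
    calc μ (D k) ≤ μ (D k ∩ Cᶜ) + μ (T k ⁻¹' (D k ∩ Cᶜ)) :=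
          (measure_mono hsub).trans (measure_union_le _ _)
      _ = 2 * μ (D k ∩ Cᶜ) := by
          rw [(hμ _).measure_preimage ((hD k).inter hC.compl).nullMeasurableSet, two_mul]
  have hU : {y | ∀ k, {i | r i ≤ k}.indicator y ∈ C}ᶜ = ⋃ k, D k := by
    rw [iUnion_disjointed]
    ext y
    simp [A, π]
  have hdisj : Pairwise (Function.onFun Disjoint D) := disjoint_disjointed A
  calc μ {y | ∀ k, {i | r i ≤ k}.indicator y ∈ C}ᶜ = ∑' k, μ (D k) := by
        rw [hU, measure_iUnion hdisj hD]
    _ ≤ ∑' k, 2 * μ (D k ∩ Cᶜ) := ENNReal.tsum_le_tsum hle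
    _ = 2 * μ (⋃ k, D k ∩ Cᶜ) := by
        rw [ENNReal.tsum_mul_left, measure_iUnion _ fun k => (hD k).inter hC.compl]
        exact fun i j hij => (hdisj hij).mono Set.inter_subset_left Set.inter_subset_left
    _ ≤ 2 * μ Cᶜ := by
        gcongr
        exact Set.iUnion_subset fun k => Set.inter_subset_right

/-- The maximal inequality for several ranks at once, by iteration over the ranks. -/
theorem measure_compl_forall_indicator_mem_le_pow {ι κ : Type*} [Fintype ι] [Finite κ]
    {μ : Measure (ι → ℝ)}
    (hμ : ∀ A : Set ι, MeasurePreserving (fun y => (2 : ℝ) • A.indicator y - y) μ μ)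
    (r : ι → κ → ℕ) {C : Set (ι → ℝ)} (hC : MeasurableSet C) (hconv : Convex ℝ C)
    (s : Finset κ) :
    μ {y | ∀ k : κ → ℕ, {i | ∀ a ∈ s, r i a ≤ k a}.indicator y ∈ C}ᶜ ≤ 2 ^ s.card * μ Cᶜ := by
  classical
  induction s using Finset.induction_on with
  | empty => simp [Set.compl_def]
  | insert a s ha ih =>
    -- `B` is again measurable and convex, so the one-rank inequality applies with `B` in place of
    -- `C`. This is why convex sets replace balls.
    set B := {y | ∀ k : κ → ℕ, {i | ∀ a ∈ s, r i a ≤ k a}.indicator y ∈ C} with hB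
    have hBeq : B = ⋂ k : κ → ℕ, {y | {i | ∀ a ∈ s, r i a ≤ k a}.indicator y ∈ C} := by
      ext; simp [hB]
    have hBm : MeasurableSet B := by
      rw [hBeq]
      refine MeasurableSet.iInter fun k => ?_
      exact measurableSet_preimage (measurable_pi_indicator _) hC
    have hBc : Convex ℝ B := by
      intro x hx y hy u v hu hv huv k
      convert! hconv (hx k) (hy k) hu hv huv using 1
      ext i
      simp only [Set.indicator, Pi.add_apply, Pi.smul_apply]
      split_ifs <;> simp
    calc μ {y | ∀ k : κ → ℕ, {i | ∀ b ∈ insert a s, r i b ≤ k b}.indicator y ∈ C}ᶜ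
        ≤ μ {y | ∀ k, {i | r i a ≤ k}.indicator y ∈ B}ᶜ := by
          refine measure_mono (Set.compl_subset_compl.2 fun y hy k => ?_)
          have := hy (k a) k
          rw [Set.indicator_indicator] at this
          convert! this using 2
          ext i
          simp [and_comm]
      _ ≤ 2 * μ Bᶜ := measure_compl_forall_indicator_mem_le hμ _ hBm hBc
      _ ≤ 2 * (2 ^ s.card * μ Cᶜ) := by gcongr
      _ = 2 ^ (insert a s).card * μ Cᶜ := by
          rw [Finset.card_insert_of_notMem ha, pow_succ]; ring

/-! ### Finite additivity and joint laws of `M` -/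

namespace IsSymmetricStableRandomMeasure

variable {Ω E β : Type*} [MeasurableSpace Ω] [MeasurableSpace E] {α : ℝ} {m : Measure E}
  {P : Measure Ω} {M : Set E → Ω → ℝ}

/-- The series of copies of `M ∅` converges, so its constant increment is zero. -/
theorem ae_empty (hM : IsSymmetricStableRandomMeasure α m P M) : M ∅ =ᵐ[P] 0 := by
  filter_upwards [hM.sigma_additive (fun _ => ∅) (fun _ => .empty) (by simp)
    (fun _ _ _ => disjoint_bot_left)] with ω h
  have h0 : M (⋃ _ : ℕ, ∅) ω = M ∅ ω := by simp
  rw [h0] at h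
  have h1 := ((tendsto_add_atTop_iff_nat 1).2 h).sub h
  simp only [Finset.sum_range_succ, add_sub_cancel_left, sub_self] at h1
  exact tendsto_nhds_unique tendsto_const_nhds h1

variable [IsFiniteMeasure m]

theorem ae_union (hM : IsSymmetricStableRandomMeasure α m P M) {A B : Set E}
    (hA : MeasurableSet A) (hB : MeasurableSet B) (hAB : Disjoint A B) :
    ∀ᵐ ω ∂P, M (A ∪ B) ω = M A ω + M B ω := by
  let S : ℕ → Set E := fun n => match n with
    | 0 => A
    | 1 => B
    | _ => ∅
  have hS : ⋃ n, S n = A ∪ B := by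
    ext x
    simp only [Set.mem_iUnion, Set.mem_union]
    constructor
    · rintro ⟨_ | _ | n, h⟩
      exacts [Or.inl h, Or.inr h, h.elim]
    · rintro (h | h)
      exacts [⟨0, h⟩, ⟨1, h⟩]
  have hSm : ∀ n, MeasurableSet (S n) := by
    rintro (_ | _ | n)
    exacts [hA, hB, .empty]
  have hdisj : Pairwise fun i j => Disjoint (S i) (S j) := by
    rintro (_ | _ | i) (_ | _ | j) hij
    all_goals first
      | exact absurd rfl hij
      | exact hAB
      | exact hAB.symm
      | exact disjoint_bot_right
      | exact disjoint_bot_left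
  filter_upwards [hM.sigma_additive S hSm (measure_lt_top _ _) hdisj, hM.ae_empty] with ω h h0
  rw [hS] at h
  refine tendsto_nhds_unique h (tendsto_const_nhds.congr' ?_)
  filter_upwards [eventually_ge_atTop 2] with n hn
  obtain ⟨k, rfl⟩ := Nat.exists_eq_add_of_le' hn
  rw [Finset.sum_range_succ', Finset.sum_range_succ']
  have : ∑ j ∈ Finset.range k, M (S (j + 1 + 1)) ω = 0 := Finset.sum_eq_zero fun j _ => h0
  rw [this, zero_add, add_comm]
  rfl

theorem ae_preimage_finset (hM : IsSymmetricStableRandomMeasure α m P M) (h : SimpleFunc E β)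
    (s : Finset β) :
    ∀ᵐ ω ∂P, M (h ⁻¹' s) ω = ∑ b ∈ s, M (h ⁻¹' {b}) ω := by
  classical
  induction s using Finset.induction_on with
  | empty =>
    filter_upwards [hM.ae_empty] with ω h0
    simpa using h0
  | insert b s hb ih =>
    have hdisj : Disjoint (h ⁻¹' {b}) (h ⁻¹' s) :=
      Disjoint.preimage _ (by simpa using hb)
    filter_upwards [ih, hM.ae_union (h.measurableSet_preimage _) (h.measurableSet_preimage _)
      hdisj] with ω h1 h2
    rw [Finset.sum_insert hb, ← h1, ← h2, Finset.coe_insert, Set.insert_eq, Set.preimage_union]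

open Classical in
theorem ae_preimage (hM : IsSymmetricStableRandomMeasure α m P M) (h : SimpleFunc E β)
    (S : Set β) :
    ∀ᵐ ω ∂P, M (h ⁻¹' S) ω = ∑ b ∈ h.range with b ∈ S, M (h ⁻¹' {b}) ω := by
  have : h ⁻¹' S = h ⁻¹' (h.range.filter (· ∈ S)) := by
    ext x
    simp
  rw [this]
  exact hM.ae_preimage_finset h _

/-- Allows an integral to be computed on a finer partition, so that two simple functions can be
compared on a common one. -/
theorem ae_simpleStochIntegral_map (hM : IsSymmetricStableRandomMeasure α m P M)
    (h : SimpleFunc E β) (φ : β → ℝ) :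
    ∀ᵐ ω ∂P, simpleStochIntegral M (h.map φ) ω = ∑ b ∈ h.range, φ b * M (h ⁻¹' {b}) ω := by
  classical
  have := (ae_ball_iff (h.map φ).range.countable_toSet).2 fun c _ => hM.ae_preimage h (φ ⁻¹' {c})
  filter_upwards [this] with ω hω
  rw [simpleStochIntegral, SimpleFunc.range_map]
  refine Finset.sum_image' _ fun b hb => ?_
  have h1 := hω (φ b) (by rw [SimpleFunc.range_map]; exact Finset.mem_image_of_mem _ hb)
  rw [SimpleFunc.coe_map, Set.preimage_comp, h1, Finset.mul_sum]
  refine Finset.sum_congr rfl fun c hc => ?_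
  rw [(Finset.mem_filter.1 hc).2]

theorem measurable_preimage (hM : IsSymmetricStableRandomMeasure α m P M) (h : SimpleFunc E β)
    (S : Set β) : Measurable (M (h ⁻¹' S)) :=
  hM.measurable _ (h.measurableSet_preimage _) (measure_lt_top _ _)

theorem iIndepFun_fibers (hM : IsSymmetricStableRandomMeasure α m P M) (h : SimpleFunc E β) :
    iIndepFun (fun b : h.range => M (h ⁻¹' {(b : β)})) P := by
  let e := Fintype.equivFin h.range
  have := hM.indep _ (fun i => h ⁻¹' {(e.symm i : β)}) (fun i => h.measurableSet_preimage _)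
    (fun i => measure_lt_top _ _) (fun i j hij => Disjoint.preimage _ (by
      simpa [Subtype.ext_iff] using fun hc => hij (e.symm.injective (Subtype.ext hc))))
  have h2 := this.precomp e.injective
  simpa using h2

theorem charFun_map (hM : IsSymmetricStableRandomMeasure α m P M) (hα : 0 < α) {A : Set E}
    (hA : MeasurableSet A) (t : ℝ) :
    charFun (P.map (M A)) t = ((Real.exp (-(m.real A * |t| ^ α)) : ℝ) : ℂ) := by
  rw [(hM.law A hA (measure_lt_top _ _)).2 t, ← Real.rpow_mul ENNReal.toReal_nonneg,
    one_div_mul_cancel hα.ne', Real.rpow_one]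
  rfl

/-- The law of `∑ c_b M(h = b)` is symmetric `α`-stable with scale `(∑ |c_b|^α m(h = b))^(1/α)`. -/
theorem charFun_map_sum (hM : IsSymmetricStableRandomMeasure α m P M) (hα : 0 < α)
    (h : SimpleFunc E β) (φ : β → ℝ) (t : ℝ) :
    charFun (P.map fun ω => ∑ b ∈ h.range, φ b * M (h ⁻¹' {b}) ω) t =
      ((Real.exp (-((∑ b ∈ h.range, |φ b| ^ α * m.real (h ⁻¹' {b})) * |t| ^ α)) : ℝ) : ℂ) := by
  have hm : ∀ b : h.range, Measurable (M (h ⁻¹' {(b : β)})) := fun b => hM.measurable_preimage h _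
  have hind : iIndepFun (fun (b : h.range) ω => φ b * M (h ⁻¹' {(b : β)}) ω) P :=
    (hM.iIndepFun_fibers h).comp (fun b x => φ b * x) fun b => measurable_const_mul _
  have h1 : ∀ ω, ∑ b ∈ h.range, φ b * M (h ⁻¹' {b}) ω =
      ∑ b : h.range, φ b * M (h ⁻¹' {(b : β)}) ω := fun ω =>
    (Finset.sum_coe_sort h.range fun b => φ b * M (h ⁻¹' {b}) ω).symm
  simp_rw [h1]
  rw [hind.charFun_map_fun_sum_eq_prod fun b => ((hm b).const_mul _).aemeasurable,
    Finset.prod_apply]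
  have h2 : ∀ b : h.range, charFun (P.map fun ω => φ b * M (h ⁻¹' {(b : β)}) ω) t =
      ((Real.exp (-(|φ b| ^ α * m.real (h ⁻¹' {(b : β)}) * |t| ^ α)) : ℝ) : ℂ) := by
    intro b
    rw [charFun_map_mul_comp (hm b).aemeasurable,
      hM.charFun_map hα (h.measurableSet_preimage _), abs_mul,
      Real.mul_rpow (abs_nonneg _) (abs_nonneg _)]
    congr 3
    ring
  simp_rw [h2]
  rw [← Complex.ofReal_prod, ← Real.exp_sum, Finset.sum_neg_distrib, ← Finset.sum_mul,
    Finset.sum_coe_sort h.range fun b => |φ b| ^ α * m.real (h ⁻¹' {b})]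

theorem map_neg (hM : IsSymmetricStableRandomMeasure α m P M) [IsProbabilityMeasure P]
    (hα : 0 < α) {A : Set E} (hA : MeasurableSet A) :
    MeasurePreserving (fun x : ℝ => -x) (P.map (M A)) (P.map (M A)) := by
  refine ⟨measurable_neg, ?_⟩
  have := Measure.isProbabilityMeasure_map (μ := P)
    (hM.measurable A hA (measure_lt_top _ _)).aemeasurable
  refine Measure.ext_of_charFun (funext fun t => ?_)
  have h1 : (fun x : ℝ => -x) = ((-1 : ℝ) * ·) := by ext; simp
  rw [h1, charFun_map_mul, hM.charFun_map hα hA, hM.charFun_map hα hA]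
  simp

/-- The joint law of the values on the fibres of a simple function is invariant under changes of
sign. -/
theorem measurePreserving_reflect (hM : IsSymmetricStableRandomMeasure α m P M)
    [IsProbabilityMeasure P] (hα : 0 < α) (h : SimpleFunc E β) (A : Set h.range) :
    MeasurePreserving (fun y => (2 : ℝ) • A.indicator y - y)
      (P.map fun ω (b : h.range) => M (h ⁻¹' {(b : β)}) ω)
      (P.map fun ω (b : h.range) => M (h ⁻¹' {(b : β)}) ω) := by
  classical
  have hm : ∀ b : h.range, Measurable (M (h ⁻¹' {(b : β)})) := fun b => hM.measurable_preimage h _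
  have : ∀ b : h.range, IsProbabilityMeasure (P.map (M (h ⁻¹' {(b : β)}))) := fun b =>
    Measure.isProbabilityMeasure_map (hm b).aemeasurable
  rw [(iIndepFun_iff_map_fun_eq_pi_map fun b => (hm b).aemeasurable).1 (hM.iIndepFun_fibers h)]
  let f : h.range → ℝ → ℝ := fun b x => if b ∈ A then x else -x
  have hf : (fun y : h.range → ℝ => (2 : ℝ) • A.indicator y - y) = fun y b => f b (y b) := by
    ext y b
    by_cases hb : b ∈ A <;> simp [f, hb]
    ring
  rw [hf]
  refine measurePreserving_pi _ _ fun b => ?_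
  by_cases hb : b ∈ A
  · simpa only [f, hb, if_true] using! MeasurePreserving.id _
  · simpa only [f, hb, if_false] using hM.map_neg hα (h.measurableSet_preimage _)

/-- Maximal inequality for the values of `M` on the orthants of a simple function with values in
`ℕ^κ`. -/
theorem measure_exists_lt_abs_le {κ : Type*} [Fintype κ]
    (hM : IsSymmetricStableRandomMeasure α m P M)
    [IsProbabilityMeasure P] (hα : 0 < α) (h : SimpleFunc E (κ → ℕ)) (c : ℝ) :
    P {ω | ∃ k : κ → ℕ, c < |M (h ⁻¹' Set.Iic k) ω|} ≤
      2 ^ Fintype.card κ * P {ω | c < |M Set.univ ω|} := by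
  classical
  let ξ : Ω → h.range → ℝ := fun ω b => M (h ⁻¹' {(b : κ → ℕ)}) ω
  have hξ : Measurable ξ := measurable_pi_iff.2 fun b => hM.measurable_preimage h _
  -- Truncating `ξ` to an orthant and summing gives `M` of that orthant, so a bound on all orthants
  -- says that all truncations lie in `C`.
  let C : Set (h.range → ℝ) := {y | |∑ b, y b| ≤ c}
  have hC : MeasurableSet C := measurableSet_le (by fun_prop) measurable_const
  have hconv : Convex ℝ C := by
    let L : (h.range → ℝ) →ₗ[ℝ] ℝ := ∑ b, LinearMap.proj b
    have hCL : C = L ⁻¹' Set.Icc (-c) c := by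
      ext y
      simp [C, L, abs_le]
    rw [hCL]
    exact (convex_Icc _ _).linear_preimage L
  have hsum : ∀ S : Set (κ → ℕ), ∀ᵐ ω ∂P,
      M (h ⁻¹' S) ω = ∑ b, {b : h.range | (b : κ → ℕ) ∈ S}.indicator (ξ ω) b := by
    intro S
    filter_upwards [hM.ae_preimage h S] with ω hω
    rw [hω, Finset.sum_filter, ← Finset.sum_coe_sort]
    rfl
  have h1 := measure_compl_forall_indicator_mem_le_pow (hM.measurePreserving_reflect hα h)
    (fun b => (b : κ → ℕ)) hC hconv Finset.univ
  rw [Measure.map_apply hξ hC.compl] at h1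
  calc P {ω | ∃ k : κ → ℕ, c < |M (h ⁻¹' Set.Iic k) ω|}
      ≤ P (ξ ⁻¹' {y | ∀ k : κ → ℕ,
          {b : h.range | ∀ a ∈ Finset.univ, (b : κ → ℕ) a ≤ k a}.indicator y ∈ C}ᶜ) := by
        refine measure_mono_ae ?_
        -- Additivity of `M` holds only almost surely for each `k`; the corners `k` are countably
        -- many.
        filter_upwards [ae_all_iff.2 fun k => hsum (Set.Iic k)] with ω hω ⟨k, hk⟩ hcon
        refine hk.not_ge ?_
        have := hcon k
        rw [hω k]
        simpa [C, Pi.le_def] using this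
    _ ≤ P.map ξ {y | ∀ k : κ → ℕ,
          {b : h.range | ∀ a ∈ Finset.univ, (b : κ → ℕ) a ≤ k a}.indicator y ∈ C}ᶜ :=
        Measure.le_map_apply hξ.aemeasurable _
    _ ≤ 2 ^ Fintype.card κ * P (ξ ⁻¹' Cᶜ) := h1
    _ = 2 ^ Fintype.card κ * P {ω | c < |M Set.univ ω|} := by
        congr 1
        refine measure_congr ?_
        filter_upwards [hsum Set.univ] with ω hω
        refine propext ?_
        change ¬ |∑ b, ξ ω b| ≤ c ↔ c < |M Set.univ ω|
        rw [← Set.preimage_univ (f := h), hω]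
        simp

end IsSymmetricStableRandomMeasure

/-! ### Stochastic integrals of indicators -/

/-- The tail of a law is bounded by the integral of `1 - charFun` over a bounded interval, to which
dominated convergence applies. -/
theorem tendstoInMeasure_zero_of_tendsto_charFun {Ω : Type*} [MeasurableSpace Ω] {P : Measure Ω}
    [IsProbabilityMeasure P] {X : ℕ → Ω → ℝ} (hX : ∀ n, Measurable (X n))
    (h : ∀ t, Tendsto (fun n => charFun (P.map (X n)) t) atTop (𝓝 1)) :
    TendstoInMeasure P X atTop 0 := by
  have hP : ∀ n, IsProbabilityMeasure (P.map (X n)) := fun n =>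
    Measure.isProbabilityMeasure_map (hX n).aemeasurable
  rw [tendstoInMeasure_iff_measureReal_norm]
  intro ε hε
  -- The tail estimate concerns `r < |x|`, convergence in measure `ε ≤ |x|`; halving `ε` bridges the
  -- two.
  have hr : 0 < ε / 2 := by positivity
  have hint : Tendsto (fun n => ∫ t in (-2 * (ε / 2)⁻¹)..(2 * (ε / 2)⁻¹),
      1 - charFun (P.map (X n)) t) atTop (𝓝 (∫ _ in (-2 * (ε / 2)⁻¹)..(2 * (ε / 2)⁻¹), (0 : ℂ))) := by
    refine intervalIntegral.tendsto_integral_filter_of_dominated_convergence (fun _ => 2) ?_ ?_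
      (by simp) ?_
    · exact Eventually.of_forall fun n =>
        (measurable_const.sub measurable_charFun).aestronglyMeasurable
    · exact Eventually.of_forall fun n => ae_of_all _ fun t _ => norm_one_sub_charFun_le_two
    · refine ae_of_all _ fun t _ => ?_
      simpa using (tendsto_const_nhds (x := (1 : ℂ))).sub (h t)
  have hlim : Tendsto (fun n => 2⁻¹ * (ε / 2) * ‖∫ t in (-2 * (ε / 2)⁻¹)..(2 * (ε / 2)⁻¹),
      1 - charFun (P.map (X n)) t‖) atTop (𝓝 0) := by
    simpa using hint.norm.const_mul (2⁻¹ * (ε / 2))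
  refine squeeze_zero (fun n => measureReal_nonneg) (fun n => ?_) hlim
  refine le_trans ?_ (measureReal_abs_gt_le_integral_charFun hr)
  rw [map_measureReal_apply (hX n) (measurableSet_lt measurable_const (by fun_prop))]
  refine measureReal_mono fun ω hω => ?_
  simp only [Set.mem_ofPred_eq, Pi.zero_apply, sub_zero, Real.norm_eq_abs, Set.mem_preimage] at hω ⊢
  linarith

/-- The stochastic integral of the indicator function of `A` is `M A`. -/
theorem IsStochIntegral.ae_eq_of_indicator {Ω E : Type*} [MeasurableSpace Ω] [MeasurableSpace E]
    {α : ℝ} {m : Measure E} [IsFiniteMeasure m] {P : Measure Ω} [IsProbabilityMeasure P]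
    {M : Set E → Ω → ℝ} (hM : IsSymmetricStableRandomMeasure α m P M) (hα : 0 < α)
    {A : Set E} (hA : MeasurableSet A) {Y : Ω → ℝ}
    (hY : IsStochIntegral α m P M (A.indicator fun _ => 1) Y) : Y =ᵐ[P] M A := by
  classical
  obtain ⟨-, g, -, hg, hgY⟩ := hY
  let i : SimpleFunc E ℝ := SimpleFunc.piecewise A hA (SimpleFunc.const E 1) (SimpleFunc.const E 0)
  have hi : ∀ x, i x = A.indicator (fun _ => 1) x := fun x => by
    by_cases hx : x ∈ A <;> simp [i, hx]
  let h : ℕ → SimpleFunc E (ℝ × ℝ) := fun k => (g k).pair i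
  let φ : ℝ × ℝ → ℝ := fun b => b.1 - b.2
  let Z : ℕ → Ω → ℝ := fun k ω => ∑ b ∈ (h k).range, φ b * M (h k ⁻¹' {b}) ω
  have hZ : ∀ k, Measurable (Z k) := fun k =>
    Finset.measurable_fun_sum _ fun b _ => (hM.measurable_preimage (h k) _).const_mul _
  have hdiff : ∀ k, ∀ᵐ ω ∂P, simpleStochIntegral M (g k) ω - M A ω = Z k ω := by
    intro k
    have hgk : (h k).map Prod.fst = g k := by ext; rfl
    have hAk : h k ⁻¹' {b | b.2 = 1} = A := by
      ext x
      by_cases hx : x ∈ A <;> simp [h, hi, hx]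
    filter_upwards [hM.ae_simpleStochIntegral_map (h k) Prod.fst,
      hM.ae_preimage (h k) {b | b.2 = 1}] with ω h1 h2
    rw [hgk] at h1
    rw [hAk] at h2
    rw [h1, h2, Finset.sum_filter, ← Finset.sum_sub_distrib]
    refine Finset.sum_congr rfl fun b hb => ?_
    obtain ⟨x, rfl⟩ := SimpleFunc.mem_range.1 hb
    by_cases hx : x ∈ A <;> simp [h, hi, hx, φ, sub_mul]
  -- `s k` is the integral of `|g k - 1_A|^α`, and also the `α`-th power of the scale of the stable
  -- variable `Z k`.
  let s : ℕ → ℝ := fun k => ∑ b ∈ (h k).range, |φ b| ^ α * m.real (h k ⁻¹' {b})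
  have hs : ∀ k, ENNReal.ofReal (s k) =
      eLpNorm (fun x => g k x - A.indicator (fun _ => 1) x) (ENNReal.ofReal α) m ^ α := by
    intro k
    rw [eLpNorm_eq_lintegral_rpow_enorm_toReal (by simpa using hα) (by simp),
      ENNReal.toReal_ofReal hα.le, ← ENNReal.rpow_mul, one_div_mul_cancel hα.ne', ENNReal.rpow_one]
    calc ENNReal.ofReal (s k)
        = ∑ b ∈ (h k).range, ‖φ b‖ₑ ^ α * m (h k ⁻¹' {b}) := by
          rw [ENNReal.ofReal_sum_of_nonneg fun b _ => by positivity]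
          refine Finset.sum_congr rfl fun b _ => ?_
          rw [ENNReal.ofReal_mul (by positivity), ofReal_measureReal,
            ← ENNReal.ofReal_rpow_of_nonneg (abs_nonneg _) hα.le, Real.enorm_eq_ofReal_abs]
      _ = ((h k).map fun b => ‖φ b‖ₑ ^ α).lintegral m := (SimpleFunc.map_lintegral _ _).symm
      _ = _ := by
          rw [← SimpleFunc.lintegral_eq_lintegral]
          refine lintegral_congr fun x => ?_
          simp [h, hi, φ]
  have hs0 : Tendsto s atTop (𝓝 0) := by
    have h1 : Tendsto (fun k => ENNReal.ofReal (s k)) atTop (𝓝 0) := by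
      simp_rw [hs]
      have := (ENNReal.continuous_rpow_const (y := α)).continuousAt.tendsto.comp hg
      simpa [ENNReal.zero_rpow_of_pos hα, Function.comp_def] using this
    have h2 := (ENNReal.tendsto_toReal ENNReal.zero_ne_top).comp h1
    refine h2.congr fun k => ENNReal.toReal_ofReal ?_
    exact Finset.sum_nonneg fun b _ => by positivity
  have hZ0 : TendstoInMeasure P Z atTop 0 := by
    refine tendstoInMeasure_zero_of_tendsto_charFun hZ fun t => ?_
    have h1 : Tendsto (fun k => Real.exp (-(s k * |t| ^ α))) atTop (𝓝 1) := by
      have := (Real.continuous_exp.tendsto _).comp (hs0.mul_const (|t| ^ α)).neg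
      simpa [Function.comp_def] using this
    have h2 := (Complex.continuous_ofReal.tendsto _).comp h1
    rw [Complex.ofReal_one] at h2
    exact h2.congr fun k => (hM.charFun_map_sum hα (h k) φ t).symm
  have hgA : TendstoInMeasure P (fun k => simpleStochIntegral M (g k)) atTop (M A) := by
    rw [tendstoInMeasure_iff_norm] at hZ0 ⊢
    intro ε hε
    refine (hZ0 ε hε).congr fun k => measure_congr ?_
    filter_upwards [hdiff k] with ω hω
    refine propext ?_
    change ε ≤ ‖Z k ω - 0‖ ↔ ε ≤ ‖simpleStochIntegral M (g k) ω - M A ω‖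
    rw [hω, sub_zero]
  exact tendstoInMeasure_ae_unique hgY hgA

/-! ### Continuity from above -/

namespace IsSymmetricStableRandomMeasure

variable {Ω E : Type*} [MeasurableSpace Ω] [MeasurableSpace E] {α : ℝ} {m : Measure E}
  [IsFiniteMeasure m] {P : Measure Ω} {M : Set E → Ω → ℝ}

/-- The set `A 0` splits into the intersection and the differences `A n \ A (n + 1)`, over which the
sum telescopes. -/
theorem ae_tendsto_iInter (hM : IsSymmetricStableRandomMeasure α m P M) {A : ℕ → Set E}
    (hA : ∀ n, MeasurableSet (A n)) (hanti : Antitone A) :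
    ∀ᵐ ω ∂P, Tendsto (fun n => M (A n) ω) atTop (𝓝 (M (⋂ n, A n) ω)) := by
  let B : ℕ → Set E := fun n => A n \ A (n + 1)
  have hB : ∀ n, MeasurableSet (B n) := fun n => (hA n).diff (hA _)
  have hlt : ∀ i j, i < j → Disjoint (B i) (B j) := fun i j hij =>
    Set.disjoint_left.2 fun x hi hj => hi.2 (hanti (Nat.succ_le_of_lt hij) hj.1)
  have hdisj : Pairwise fun i j => Disjoint (B i) (B j) := fun i j hij =>
    (lt_or_gt_of_ne hij).elim (hlt i j) fun h => (hlt j i h).symm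
  have h0 : (⋂ n, A n) ∪ ⋃ n, B n = A 0 := by
    ext x
    simp only [Set.mem_union, Set.mem_iInter, Set.mem_iUnion]
    refine ⟨fun h => h.elim (fun h => h 0) fun ⟨n, hn⟩ => hanti (Nat.zero_le n) hn.1, fun hx => ?_⟩
    by_contra! hcon
    obtain ⟨⟨n, hn⟩, hcon⟩ := hcon
    refine hn (n.rec hx fun k hk => ?_)
    by_contra hk'
    exact hcon k ⟨hk, hk'⟩
  have hd0 : Disjoint (⋂ n, A n) (⋃ n, B n) :=
    Set.disjoint_left.2 fun x hx hx' => by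
      obtain ⟨n, hn⟩ := Set.mem_iUnion.1 hx'
      exact hn.2 (Set.mem_iInter.1 hx _)
  have hstep : ∀ n, ∀ᵐ ω ∂P, M (A n) ω = M (A (n + 1)) ω + M (B n) ω := fun n => by
    have := hM.ae_union (hA (n + 1)) (hB n) Set.disjoint_sdiff_right
    rwa [Set.union_sdiff_cancel (hanti n.le_succ)] at this
  have h1 := hM.ae_union (MeasurableSet.iInter hA) (MeasurableSet.iUnion hB) hd0
  rw [h0] at h1
  filter_upwards [hM.sigma_additive B hB (measure_lt_top _ _) hdisj, ae_all_iff.2 hstep, h1]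
    with ω hσ hst h1
  have hsum : ∀ n, ∑ j ∈ Finset.range n, M (B j) ω = M (A 0) ω - M (A n) ω := by
    intro n
    rw [← Finset.sum_range_sub' fun j => M (A j) ω]
    exact Finset.sum_congr rfl fun j _ => by rw [hst j]; ring
  simp_rw [hsum] at hσ
  have := (tendsto_const_nhds (x := M (A 0) ω)).sub hσ
  simpa [h1] using this

end IsSymmetricStableRandomMeasure

/-! ### Dyadic orthants -/

instance isFiniteMeasure_cubeMeasure (d : ℕ) : IsFiniteMeasure (cubeMeasure d) := by
  refine ⟨?_⟩
  have he : MeasurableEmbedding (Subtype.val : Cube d → Fin d → ℝ) :=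
    MeasurableEmbedding.subtype_coe measurableSet_Icc
  rw [cubeMeasure, he.comap_apply]
  exact (measure_mono (Subtype.coe_image_subset _ _)).trans_lt isCompact_Icc.measure_lt_top

/-- The upper corner of the dyadic cell of generation `n` that contains `x`, scaled by `2^n`. -/
noncomputable def dyadicCeil (d n : ℕ) : SimpleFunc (Cube d) (Fin d → ℕ) where
  toFun x i := ⌈2 ^ n * (x : Fin d → ℝ) i⌉₊
  measurableSet_fiber' k := by
    have h : Measurable fun (x : Cube d) (i : Fin d) => ⌈2 ^ n * (x : Fin d → ℝ) i⌉₊ :=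
      measurable_pi_iff.2 fun i => Nat.measurable_ceil.comp
        (((measurable_pi_apply i).comp measurable_subtype_coe).const_mul _)
    exact h (measurableSet_singleton k)
  finite_range' := by
    refine (Set.finite_Icc 0 fun _ => 2 ^ n).subset ?_
    rintro _ ⟨x, rfl⟩
    refine ⟨fun i => Nat.zero_le _, fun i => Nat.ceil_le.2 ?_⟩
    push_cast
    exact mul_le_of_le_one_right (by positivity) (x.2.2 i)

theorem dyadicCeil_apply {d n : ℕ} (x : Cube d) (i : Fin d) :
    dyadicCeil d n x i = ⌈2 ^ n * (x : Fin d → ℝ) i⌉₊ := rfl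

theorem mem_dyadicCeil_preimage_Iic {d n : ℕ} {k : Fin d → ℕ} {x : Cube d} :
    x ∈ dyadicCeil d n ⁻¹' Set.Iic k ↔ ∀ i, 2 ^ n * (x : Fin d → ℝ) i ≤ k i := by
  simp only [Set.mem_preimage, Set.mem_Iic, Pi.le_def, dyadicCeil_apply, Nat.ceil_le]

/-- The grids are nested: corner `k` of one generation is corner `2k` of the next. -/
theorem dyadicCeil_preimage_Iic_succ {d n : ℕ} (k : Fin d → ℕ) :
    dyadicCeil d (n + 1) ⁻¹' Set.Iic (fun i => 2 * k i) = dyadicCeil d n ⁻¹' Set.Iic k := by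
  ext x
  simp only [mem_dyadicCeil_preimage_Iic]
  refine forall_congr' fun i => ?_
  push_cast
  rw [pow_succ', mul_assoc, mul_le_mul_iff_right₀ two_pos]

theorem antitone_dyadicCeil_preimage {d : ℕ} (x : Cube d) :
    Antitone fun n => dyadicCeil d n ⁻¹' Set.Iic (dyadicCeil d n x) := by
  refine antitone_nat_of_succ_le fun n => ?_
  rw [← dyadicCeil_preimage_Iic_succ (dyadicCeil d n x)]
  refine Set.preimage_mono (Set.Iic_subset_Iic.2 fun i => ?_)
  rw [dyadicCeil_apply, dyadicCeil_apply, Nat.ceil_le]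
  push_cast
  rw [pow_succ', mul_assoc, mul_le_mul_iff_right₀ two_pos]
  exact Nat.le_ceil _

/-- The rounded corner exceeds `x` by less than `2^(-n)` in each coordinate. Rounding up makes the
limit the closed orthant exactly. -/
theorem iInter_dyadicCeil_preimage {d : ℕ} (x : Cube d) :
    ⋂ n, dyadicCeil d n ⁻¹' Set.Iic (dyadicCeil d n x) =
      {x' : Cube d | ∀ i, (x' : Fin d → ℝ) i ≤ (x : Fin d → ℝ) i} := by
  ext y
  simp only [Set.mem_iInter, mem_dyadicCeil_preimage_Iic]
  constructor
  · intro h i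
    refine le_of_forall_pos_le_add fun ε hε => ?_
    obtain ⟨n, hn⟩ := exists_pow_lt_of_lt_one hε (by norm_num : (2⁻¹ : ℝ) < 1)
    have h1 : (2 : ℝ) ^ n * (y : Fin d → ℝ) i < 2 ^ n * (x : Fin d → ℝ) i + 1 :=
      (h n i).trans_lt (Nat.ceil_lt_add_one (mul_nonneg (by positivity) (x.2.1 i)))
    have h2 : (1 : ℝ) < 2 ^ n * ε := by
      rwa [inv_pow, inv_lt_iff_one_lt_mul₀ (by positivity), mul_comm] at hn
    have h3 : (2 : ℝ) ^ n * (y : Fin d → ℝ) i < 2 ^ n * ((x : Fin d → ℝ) i + ε) := by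
      linarith
    exact (lt_of_mul_lt_mul_left h3 (by positivity)).le
  · intro h n i
    exact (mul_le_mul_of_nonneg_left (h i) (by positivity)).trans (Nat.le_ceil _)

/-- The values of `M` on the dyadic orthants are almost surely bounded. -/
theorem IsSymmetricStableRandomMeasure.ae_exists_forall_abs_le {d : ℕ} {Ω : Type*}
    [MeasurableSpace Ω] {P : Measure Ω} [IsProbabilityMeasure P] {α : ℝ} (hα : 0 < α)
    {M : Set (Cube d) → Ω → ℝ} (hM : IsSymmetricStableRandomMeasure α (cubeMeasure d) P M) :
    ∀ᵐ ω ∂P, ∃ c : ℕ, ∀ n k, |M (dyadicCeil d n ⁻¹' Set.Iic k) ω| ≤ c := by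
  have hbound : ∀ c : ℕ, P {ω | ∃ n k, (c : ℝ) < |M (dyadicCeil d n ⁻¹' Set.Iic k) ω|} ≤
      2 ^ d * P {ω | (c : ℝ) < |M Set.univ ω|} := by
    intro c
    let B : ℕ → Set Ω := fun n => {ω | ∃ k, (c : ℝ) < |M (dyadicCeil d n ⁻¹' Set.Iic k) ω|}
    -- Nested grids make the events increase with `n`, so a bound uniform in `n` passes to their
    -- union.
    have hmono : Monotone B := by
      refine monotone_nat_of_le_succ fun n ω ⟨k, hk⟩ => ⟨fun i => 2 * k i, ?_⟩
      rwa [dyadicCeil_preimage_Iic_succ]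
    have hU : {ω | ∃ n k, (c : ℝ) < |M (dyadicCeil d n ⁻¹' Set.Iic k) ω|} = ⋃ n, B n := by
      ext ω
      simp [B]
    rw [hU, hmono.measure_iUnion]
    refine iSup_le fun n => ?_
    simpa using hM.measure_exists_lt_abs_le hα (dyadicCeil d n) c
  have hm : Measurable (M Set.univ) := hM.measurable _ .univ (measure_lt_top _ _)
  have hlim : Tendsto (fun c : ℕ => P {ω | (c : ℝ) < |M Set.univ ω|}) atTop (𝓝 0) := by
    have h1 := tendsto_measure_iInter_atTop (μ := P)
      (s := fun c : ℕ => {ω | (c : ℝ) < |M Set.univ ω|})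
      (fun c => (measurableSet_lt measurable_const (by fun_prop)).nullMeasurableSet)
      (fun a b hab ω (hω : (b : ℝ) < |M Set.univ ω|) =>
        lt_of_le_of_lt (Nat.cast_le.2 hab : (a : ℝ) ≤ b) hω) ⟨0, measure_ne_top _ _⟩
    have h2 : ⋂ c : ℕ, {ω | (c : ℝ) < |M Set.univ ω|} = ∅ := by
      ext ω
      simpa using exists_nat_ge |M Set.univ ω|
    rwa [h2, measure_empty] at h1
  have hlim' : Tendsto (fun c : ℕ => 2 ^ d * P {ω | (c : ℝ) < |M Set.univ ω|}) atTop (𝓝 0) := by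
    simpa using ENNReal.Tendsto.const_mul hlim (Or.inr (by simp))
  rw [ae_iff]
  refine le_antisymm (ge_of_tendsto' hlim' fun c => (measure_mono ?_).trans (hbound c)) zero_le
  intro ω hω
  by_contra hcon
  refine hω ⟨c, fun n k => ?_⟩
  by_contra hlt
  exact hcon ⟨n, k, not_le.1 hlt⟩

/-! ### Random step functions in `L^p` -/

/-- Written as a combination of fixed vectors of `L^p`, a random step function is visibly measurable
in `ω`. -/
theorem sum_smul_indicatorConstLp_ae_eq {E β : Type*} [MeasurableSpace E] {m : Measure E}
    [IsFiniteMeasure m] (p : ℝ≥0∞) [Fact (1 ≤ p)] (h : SimpleFunc E β) (a : β → ℝ) :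
    ((∑ b ∈ h.range, a b • indicatorConstLp p (h.measurableSet_preimage {b})
      (measure_ne_top m _) (1 : ℝ) : ↥(Lp ℝ p m)) : E → ℝ) =ᵐ[m] fun x => a (h x) := by
  classical
  have key : ∀ s : Finset β,
      ((∑ b ∈ s, a b • indicatorConstLp p (h.measurableSet_preimage {b})
        (measure_ne_top m _) (1 : ℝ) : ↥(Lp ℝ p m)) : E → ℝ) =ᵐ[m]
        fun x => ∑ b ∈ s, if h x = b then a b else 0 := by
    intro s
    induction s using Finset.induction_on with
    | empty => simpa using! Lp.coeFn_zero ℝ p m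
    | insert b s hb ih =>
      rw [Finset.sum_insert hb]
      filter_upwards [ih, Lp.coeFn_add (a b • indicatorConstLp p (h.measurableSet_preimage {b})
        (measure_ne_top m _) (1 : ℝ)) (∑ b ∈ s, a b • indicatorConstLp p
        (h.measurableSet_preimage {b}) (measure_ne_top m _) (1 : ℝ)),
        Lp.coeFn_smul (a b) (indicatorConstLp p (h.measurableSet_preimage {b})
        (measure_ne_top m _) (1 : ℝ)), indicatorConstLp_coeFn (p := p)
        (hs := h.measurableSet_preimage {b}) (hμs := measure_ne_top m _) (c := (1 : ℝ))]
        with x h1 h2 h3 h4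
      rw [h2, Pi.add_apply, h1, h3, Pi.smul_apply, h4, Finset.sum_insert hb]
      by_cases hx : h x = b <;> simp [hx, Set.indicator]
  filter_upwards [key h.range] with x hx
  rw [hx]
  simp

/-- A random field that is the pointwise limit of a bounded sequence of random simple functions is
an `L^p`-valued random variable. -/
theorem exists_measurable_toLp {Ω E β : Type*} [MeasurableSpace Ω] [MeasurableSpace E]
    {m : Measure E} [IsFiniteMeasure m] {P : Measure Ω} (p : ℝ≥0∞) [hp : Fact (1 ≤ p)]
    (hp' : p ≠ ∞) (h : ℕ → SimpleFunc E β) (F : ℕ → β → Ω → ℝ) (hF : ∀ n b, Measurable (F n b))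
    (hbdd : ∀ᵐ ω ∂P, ∃ c : ℕ, ∀ n b, |F n b ω| ≤ c) (W : E → Ω → ℝ)
    (hlim : ∀ᵐ ω ∂P, ∀ᵐ x ∂m, Tendsto (fun n => F n (h n x) ω) atTop (𝓝 (W x ω))) :
    ∃ X : Ω → Lp ℝ p m, Measurable[_, borel (Lp ℝ p m)] X ∧
      ∀ᵐ ω ∂P, (X ω : E → ℝ) =ᵐ[m] fun x => W x ω := by
  classical
  let X : ℕ → Ω → Lp ℝ p m := fun n ω => ∑ b ∈ (h n).range, F n b ω •
    indicatorConstLp p ((h n).measurableSet_preimage {b}) (measure_ne_top m _) (1 : ℝ)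
  have hX : ∀ n, StronglyMeasurable (X n) := fun n =>
    Finset.stronglyMeasurable_fun_sum _ fun b _ => (hF n b).stronglyMeasurable.smul_const _
  have hXF : ∀ n ω, (X n ω : E → ℝ) =ᵐ[m] fun x => F n (h n x) ω := fun n ω =>
    sum_smul_indicatorConstLp_ae_eq p (h n) fun b => F n b ω
  let Y : Ω → Lp ℝ p m := fun ω =>
    if hω : MemLp (fun x => W x ω) p m then hω.toLp _ else 0
  have hY : ∀ᵐ ω ∂P, MemLp (fun x => W x ω) p m ∧ Tendsto (fun n => X n ω) atTop (𝓝 (Y ω)) := by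
    filter_upwards [hbdd, hlim] with ω ⟨c, hc⟩ hω
    have hFm : ∀ n, AEStronglyMeasurable (fun x => F n (h n x) ω) m := fun n =>
      ((h n).map fun b => F n b ω).aestronglyMeasurable
    have hW : MemLp (fun x => W x ω) p m := by
      refine MemLp.of_bound (aestronglyMeasurable_of_tendsto_ae atTop hFm hω) c ?_
      filter_upwards [hω] with x hx
      exact le_of_tendsto' hx.norm fun n => hc n _
    refine ⟨hW, ?_⟩
    have hYω : Y ω = hW.toLp _ := dif_pos hW
    rw [hYω, Lp.tendsto_Lp_iff_tendsto_eLpNorm']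
    have hui : UnifIntegrable (fun n x => F n (h n x) ω) p m := by
      -- The threshold `c + 1` exceeds the bound `c` strictly, so the set where it is reached is
      -- empty.
      refine unifIntegrable_of hp.out hp' hFm fun ε hε => ⟨c + 1, fun n => ?_⟩
      have : {x | (c + 1 : NNReal) ≤ ‖F n (h n x) ω‖₊} = ∅ := by
        refine Set.eq_empty_of_forall_notMem fun x hx => ?_
        have h1 : (c : ℝ) + 1 ≤ |F n (h n x) ω| := by exact_mod_cast hx
        linarith [hc n (h n x)]
      rw [this, Set.indicator_empty]
      simp
    have := tendsto_Lp_finite_of_tendsto_ae hp.out hp' hFm hW hui hω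
    refine this.congr fun n => eLpNorm_congr_ae ?_
    exact (hXF n ω).symm.sub hW.coeFn_toLp.symm
  -- `Y` is only an almost sure limit, so the Borel map is a measurable modification of it.
  have hYm : AEStronglyMeasurable Y P :=
    aestronglyMeasurable_of_tendsto_ae atTop (fun n => (hX n).aestronglyMeasurable)
      (hY.mono fun ω hω => hω.2)
  refine ⟨hYm.mk Y, ?_, ?_⟩
  · let _ : MeasurableSpace (Lp ℝ p m) := borel _
    have _ : BorelSpace (Lp ℝ p m) := ⟨rfl⟩
    exact hYm.stronglyMeasurable_mk.measurable
  · filter_upwards [hY, hYm.ae_eq_mk] with ω hω hmk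
    have hYω : Y ω = hω.1.toLp _ := dif_pos hω.1
    rw [← hmk, hYω]
    exact hω.1.coeFn_toLp

/-! ### The sheet as an `L^p`-valued variable -/

theorem mainTheorem11 (d : ℕ) {Ω : Type*} [MeasurableSpace Ω] (P : Measure Ω)
    [IsProbabilityMeasure P] (α : ℝ) (hα0 : 0 < α) (hα2 : α < 2)
    (U : Cube d → Ω → ℝ) (hU : IsSymmetricStableSheet α P U) :
    (∃ V : Cube d → Ω → ℝ, IsMeasurableVersion P U V) ∧
    ∀ (p : ℝ≥0∞) [Fact (1 ≤ p)], p ≠ ∞ →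
      ∃ X : Ω → Lp ℝ p (cubeMeasure d),
        Measurable[_, borel (Lp ℝ p (cubeMeasure d))] X ∧
        ∀ V : Cube d → Ω → ℝ, IsMeasurableVersion P U V →
          ∀ᵐ ω ∂P, (X ω : Cube d → ℝ) =ᵐ[cubeMeasure d] fun x => V x ω := by
  obtain ⟨-, M, hM, hMU⟩ := hU
  let F : ℕ → (Fin d → ℕ) → Ω → ℝ := fun n k => M (dyadicCeil d n ⁻¹' Set.Iic k)
  have hF : ∀ n k, Measurable (F n k) := fun n k => hM.measurable_preimage _ _
  have hlim : ∀ x, ∀ᵐ ω ∂P, Tendsto (fun n => F n (dyadicCeil d n x) ω) atTop (𝓝 (U x ω)) := by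
    intro x
    have hA : MeasurableSet {x' : Cube d | ∀ i, (x' : Fin d → ℝ) i ≤ (x : Fin d → ℝ) i} := by
      rw [← iInter_dyadicCeil_preimage]
      exact MeasurableSet.iInter fun n => SimpleFunc.measurableSet_preimage _ _
    have h1 := hM.ae_tendsto_iInter
      (fun n => (dyadicCeil d n).measurableSet_preimage (Set.Iic (dyadicCeil d n x)))
      (antitone_dyadicCeil_preimage x)
    rw [iInter_dyadicCeil_preimage] at h1
    filter_upwards [h1, (hMU x).ae_eq_of_indicator hM hα0 hA] with ω h1 h2
    rwa [h2]
  have hFm : ∀ n, Measurable fun z : Cube d × Ω => F n (dyadicCeil d n z.1) z.2 := by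
    intro n
    have h1 : Measurable fun z : (Fin d → ℕ) × Ω => F n z.1 z.2 :=
      measurable_from_prod_countable_right (hF n)
    exact h1.comp (((dyadicCeil d n).measurable.comp measurable_fst).prodMk measurable_snd)
  -- The `limsup` is jointly measurable everywhere; its value where the sequence diverges is
  -- irrelevant, since for each `x` this has probability zero.
  let W : Cube d → Ω → ℝ := fun x ω => limsup (fun n => F n (dyadicCeil d n x) ω) atTop
  have hWm : Measurable fun z : Cube d × Ω => W z.1 z.2 := Measurable.limsup hFm
  have hWU : IsMeasurableVersion P U W :=
    ⟨hWm, fun x => (hlim x).mono fun ω hω => hω.limsup_eq⟩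
  refine ⟨⟨W, hWU⟩, fun p _ hp' => ?_⟩
  have hlimW : ∀ᵐ ω ∂P, ∀ᵐ x ∂cubeMeasure d,
      Tendsto (fun n => F n (dyadicCeil d n x) ω) atTop (𝓝 (W x ω)) := by
    refine (Measure.ae_ae_comm (p := fun x ω => Tendsto (fun n => F n (dyadicCeil d n x) ω) atTop
      (𝓝 (W x ω))) (measurableSet_tendsto_fun hFm hWm)).1 (ae_of_all _ fun x => ?_)
    filter_upwards [hlim x, hWU.2 x] with ω h1 h2
    rwa [h2]
  obtain ⟨X, hX, hXW⟩ := exists_measurable_toLp p hp' (dyadicCeil d) F hF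
    (hM.ae_exists_forall_abs_le hα0) W hlimW
  refine ⟨X, hX, fun V hV => ?_⟩
  -- By Fubini, two jointly measurable versions agree, for almost every `ω`, at almost every `x`;
  -- hence one `X` serves all `V`.
  have hVW : ∀ᵐ ω ∂P, ∀ᵐ x ∂cubeMeasure d, W x ω = V x ω := by
    refine (Measure.ae_ae_comm (p := fun x ω => W x ω = V x ω)
      (measurableSet_eq_fun hWm hV.1)).1 (ae_of_all _ fun x => ?_)
    filter_upwards [hWU.2 x, hV.2 x] with ω h1 h2
    rw [h1, h2]
  filter_upwards [hXW, hVW] with ω h1 h2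
  exact h1.trans h2
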